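/- Let $\omega^*=\beta\omega\setminus\omega$ be the space of nonprincipal ultrafilters on $\omega$, with the subspace topology from the Stone–Čech compactification $\beta\omega$ of the discrete space $\omega$, and let $\sigma:\omega^*\to\omega^*$ be the shift map, sending $p$ to the ultrafilter generated by $\{A+1 : A\in p\}$. For a topological space $X$ and a map $f:X\to X$, call $(X,f)$ a quotient of $(\omega^*,\sigma)$ if there is a continuous surjection $Q:\omega^*\to X$ with $Q\circ\sigma=f\circ Q$, and call $f$ weakly incompressible if no open $U\subseteq X$ with $\emptyset\neq U\neq X$ satisfies $f(\overline{U})\subseteq U$. The weight of $X$ is the least cardinality of a base for its topology. Assume the Continuum Hypothesis $2^{\aleph_0}=\aleph_1$. Let $X$ be a nonempty compact Hausdorff space and let $f:X\to X$ be continuous. Then the following are equivalent: (1) $(X,f)$ is a quotient of $(\omega^*,\sigma)$; (2) $X$ has weight at most $\mathfrak{c}=2^{\aleph_0}$ and $f$ is weakly incompressible; (3) $X$ is a continuous image of $\omega^*$ and $f$ is weakly incompressible. -/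

import Mathlib

/-- The remainder `ω* = βω \ ω`: the Stone–Čech compactification `βω` of the discrete space `ω` is
Mathlib's space `Ultrafilter ℕ`, and `ω` sits in it as the set of principal ultrafilters.
The topology is the subspace topology. -/
abbrev OmegaStar : Type :=
  {p : Ultrafilter ℕ // p ∉ Set.range (pure : ℕ → Ultrafilter ℕ)}

/-- The shift of a nonprincipal ultrafilter is nonprincipal. -/
theorem map_succ_notMem_range_pure (p : Ultrafilter ℕ)
    (hp : p ∉ Set.range (pure : ℕ → Ultrafilter ℕ)) :
    p.map Nat.succ ∉ Set.range (pure : ℕ → Ultrafilter ℕ) := by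
  rintro ⟨n, hn⟩
  have h : ({n} : Set ℕ) ∈ p.map Nat.succ := by
    rw [← hn]
    exact Ultrafilter.mem_pure.2 rfl
  have h' : Nat.succ ⁻¹' {n} ∈ p := Ultrafilter.mem_map.1 h
  have hfin : (Nat.succ ⁻¹' {n} : Set ℕ).Finite :=
    (Set.finite_singleton n).preimage Nat.succ_injective.injOn
  obtain ⟨a, -, ha⟩ := Ultrafilter.eq_pure_of_finite_mem hfin h'
  exact hp ⟨a, ha.symm⟩

/-- The shift map `σ : ω* → ω*`: it sends `p` to the ultrafilter `{B | {n | n + 1 ∈ B} ∈ p}`, which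
is the one generated by the sets `A + 1` with `A ∈ p`. -/
def OmegaStar.shift (p : OmegaStar) : OmegaStar :=
  ⟨p.1.map Nat.succ, map_succ_notMem_range_pure p.1 p.2⟩

/-- `(X, f)` is a quotient of `(ω*, σ)`: there is a continuous surjection `Q : ω* → X` with
`Q ∘ σ = f ∘ Q`. -/
def IsQuotientOfShift {X : Type*} [TopologicalSpace X] (f : X → X) : Prop :=
  ∃ Q : OmegaStar → X, Continuous Q ∧ Function.Surjective Q ∧ Q ∘ OmegaStar.shift = f ∘ Q

/-- `X` is a continuous image of `ω*`. -/
def IsContinuousImageOfOmegaStar (X : Type*) [TopologicalSpace X] : Prop :=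
  ∃ Q : OmegaStar → X, Continuous Q ∧ Function.Surjective Q

/-- `f` is weakly incompressible: no open `U` with `∅ ≠ U ≠ X` satisfies `f (closure U) ⊆ U`. -/
def WeaklyIncompressible {X : Type*} [TopologicalSpace X] (f : X → X) : Prop :=
  ∀ U : Set X, IsOpen U → U ≠ ∅ → U ≠ Set.univ → ¬ f '' closure U ⊆ U

/-- The weight of a topological space: the least cardinality of a base of its topology. -/
noncomputable def topologicalWeight (X : Type*) [TopologicalSpace X] : Cardinal :=
  ⨅ B : {B : Set (Set X) // TopologicalSpace.IsTopologicalBasis B}, Cardinal.mk B.1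

/-- The Continuum Hypothesis, `2 ^ ℵ₀ = ℵ₁`. -/
def ContinuumHypothesis : Prop := (Cardinal.continuum : Cardinal.{0}) = Cardinal.aleph 1

/-! The content is in (2) → (1). Let `b` enumerate a base of size at most 𝔠. A quotient map is coded
by sets `e i` of naturals: `Q p` is the one point that lies, for every `i`, in the closure of `b i`
if `e i ∈ p` and of its complement otherwise. To find `e`, cut `ω` into blocks `[k!, (k+1)!)` and on
each walk through points of `X` whose cells, in a finite partition by basic sets, are adjacent under
`f`; `e i` records when the walk is in `b i`. Weak incompressibility makes the graph of cells
strongly connected (`transGen_cellAdj`), so closed walks through all cells exist.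

CH orders the base with countable initial segments, and the `e i` are chosen by transfinite
recursion, each step (`Trackable.exists_update`) diagonalising over countably many requirements.
`Trackable` allows every finite partition `G`, also with indices not yet treated, so the next index
can be read off existing walks. Countability survives because for fixed `F` only a finite labelled
graph matters.

Adjacency yields `Q ∘ σ = f ∘ Q`; visiting every cell yields surjectivity. -/

open Set Filter Topology

/-! ### Clopen sets and compactness of `ω*`. -/

namespace OmegaStar

theorem isOpen_setOf_mem (A : Set ℕ) : IsOpen {p : OmegaStar | A ∈ p.1} :=
  (ultrafilter_isOpen_basic A).preimage continuous_subtype_val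

instance : CompactSpace OmegaStar := by
  refine isCompact_iff_compactSpace.1 (IsClosed.isCompact ?_)
  have h : IsOpen (Set.range (pure : ℕ → Ultrafilter ℕ)) := by
    rw [← Set.iUnion_singleton_eq_range]
    refine isOpen_iUnion fun n => ?_
    convert ultrafilter_isOpen_basic {n} using 1
    ext u
    constructor
    · rintro rfl
      exact Ultrafilter.mem_pure.2 rfl
    · intro hu
      obtain ⟨a, ha, rfl⟩ := Ultrafilter.eq_pure_of_finite_mem (Set.finite_singleton n) hu
      rw [Set.mem_singleton_iff.1 ha, Set.mem_singleton_iff]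
  exact h.isClosed_compl

theorem cofinite_le (p : OmegaStar) : (p.1 : Filter ℕ) ≤ cofinite := by
  intro A hA
  by_contra h
  have h' : Aᶜ ∈ p.1 := Ultrafilter.compl_mem_iff_notMem.2 h
  obtain ⟨a, -, ha⟩ := Ultrafilter.eq_pure_of_finite_mem hA h'
  exact p.2 ⟨a, ha.symm⟩

theorem infinite_of_mem (p : OmegaStar) {A : Set ℕ} (hA : A ∈ p.1) : A.Infinite := by
  intro hfin
  obtain ⟨a, -, ha⟩ := Ultrafilter.eq_pure_of_finite_mem hfin hA
  exact p.2 ⟨a, ha.symm⟩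

theorem exists_mem_of_infinite {A : Set ℕ} (hA : A.Infinite) : ∃ p : OmegaStar, A ∈ p.1 := by
  have : (cofinite ⊓ 𝓟 A).NeBot := cofinite_inf_principal_neBot_iff.2 hA
  have hle := Ultrafilter.of_le (cofinite ⊓ 𝓟 A)
  refine ⟨⟨Ultrafilter.of (cofinite ⊓ 𝓟 A), ?_⟩, hle (mem_inf_of_right (mem_principal_self A))⟩
  rintro ⟨n, hn⟩
  have h : ({n}ᶜ : Set ℕ) ∈ Ultrafilter.of (cofinite ⊓ 𝓟 A) :=
    hle (mem_inf_of_left (Set.finite_singleton n).compl_mem_cofinite)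
  rw [← hn] at h
  exact Ultrafilter.mem_pure.1 h rfl

theorem exists_setOf_mem_subset {V : Set OmegaStar} (hV : IsOpen V) {p : OmegaStar} (hp : p ∈ V) :
    ∃ A : Set ℕ, A ∈ p.1 ∧ {q : OmegaStar | A ∈ q.1} ⊆ V := by
  obtain ⟨W, hW, rfl⟩ := isOpen_induced_iff.1 hV
  obtain ⟨_, ⟨A, rfl⟩, hpA, hAW⟩ :=
    ultrafilterBasis_is_basis.exists_subset_of_mem_open (show p.1 ∈ W from hp) hW
  exact ⟨A, hpA, fun q hq => hAW hq⟩

/-- A compact set is separated from the complement of a neighbourhood by a basic clopen set. -/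
theorem exists_clopen_between {K V : Set OmegaStar} (hK : IsCompact K) (hV : IsOpen V)
    (hKV : K ⊆ V) : ∃ A : Set ℕ, K ⊆ {q | A ∈ q.1} ∧ {q : OmegaStar | A ∈ q.1} ⊆ V := by
  refine hK.induction_on (p := fun s => ∃ A : Set ℕ, s ⊆ {q | A ∈ q.1} ∧
    {q : OmegaStar | A ∈ q.1} ⊆ V) ⟨∅, by simp, fun q hq => ?_⟩ ?_ ?_ ?_
  · exact absurd hq Ultrafilter.empty_notMem
  · rintro s t hst ⟨A, h1, h2⟩
    exact ⟨A, hst.trans h1, h2⟩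
  · rintro s t ⟨A, h1, h2⟩ ⟨B, h3, h4⟩
    refine ⟨A ∪ B, ?_, ?_⟩
    · rintro q (hq | hq)
      · exact mem_of_superset (h1 hq) subset_union_left
      · exact mem_of_superset (h3 hq) subset_union_right
    · intro q hq
      rcases Ultrafilter.union_mem_iff.1 hq with h | h
      · exact h2 h
      · exact h4 h
  · intro p hp
    obtain ⟨A, hpA, hAV⟩ := exists_setOf_mem_subset hV (hKV hp)
    exact ⟨_, mem_nhdsWithin_of_mem_nhds ((isOpen_setOf_mem A).mem_nhds hpA), A, subset_rfl, hAV⟩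

/-- An infinite set has an element beyond its last exit, and from there on it is never left; so `A`
is cofinite. -/
theorem mem_of_finite_exits {A : Set ℕ} (hA : {n | n ∈ A ∧ n + 1 ∉ A}.Finite) {p : OmegaStar}
    (hp : A ∈ p.1) (q : OmegaStar) : A ∈ q.1 := by
  obtain ⟨N, hN⟩ := hA.bddAbove
  obtain ⟨m, hm, hNm⟩ := (infinite_of_mem p hp).exists_gt N
  have hall : ∀ n, m ≤ n → n ∈ A := fun n hn =>
    Nat.le_induction hm (fun n hn ih => by
      by_contra hnA
      exact absurd (hN ⟨ih, hnA⟩) (by omega)) n hn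
  refine cofinite_le q ((Set.finite_lt_nat m).subset fun n hn => ?_)
  by_contra hmn
  exact hn (hall n (not_lt.1 hmn))

end OmegaStar

/-! ### Necessary conditions on quotients and continuous images. -/

section Images

variable {X : Type*} [TopologicalSpace X]

/-- A clopen set between the preimages of `f '' closure U` and `U` is shift-invariant, hence, being
nonempty, all of `ω*`. -/
theorem WeaklyIncompressible.of_isQuotientOfShift [T2Space X] {f : X → X}
    (h : IsQuotientOfShift f) (hf : Continuous f) [CompactSpace X] : WeaklyIncompressible f := by
  obtain ⟨Q, hQ, hsurj, hcomm⟩ := h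
  intro U hU hne huniv hfU
  have hclosed : IsClosed (Q ⁻¹' (f '' closure U)) :=
    ((isClosed_closure.isCompact.image hf).isClosed).preimage hQ
  obtain ⟨A, hKA, hAU⟩ := OmegaStar.exists_clopen_between hclosed.isCompact (hU.preimage hQ)
    (preimage_mono hfU)
  have hstep : ∀ p : OmegaStar, A ∈ p.1 → A ∈ (OmegaStar.shift p).1 := by
    intro p hp
    refine hKA (a := OmegaStar.shift p) ?_
    have : Q (OmegaStar.shift p) = f (Q p) := congrFun hcomm p
    rw [mem_preimage, this]
    exact mem_image_of_mem f (subset_closure (hAU hp))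
  have hfin : {n | n ∈ A ∧ n + 1 ∉ A}.Finite := by
    by_contra hinf
    obtain ⟨p, hp⟩ := OmegaStar.exists_mem_of_infinite hinf
    have h1 : A ∈ p.1 := mem_of_superset hp fun n hn => hn.1
    have h2 : Nat.succ ⁻¹' A ∈ p.1 := hstep p h1
    obtain ⟨n, hn, hn'⟩ := Ultrafilter.nonempty_of_mem (inter_mem hp h2)
    exact hn.2 hn'
  obtain ⟨x, hx⟩ := nonempty_iff_ne_empty.2 hne
  obtain ⟨p, rfl⟩ := hsurj x
  refine huniv (eq_univ_of_forall fun y => ?_)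
  obtain ⟨q, rfl⟩ := hsurj y
  obtain ⟨p', hp'⟩ := hsurj (f (Q p))
  have hA : A ∈ p'.1 := hKA (a := p') (by
    rw [mem_preimage, hp']
    exact mem_image_of_mem f (subset_closure hx))
  exact hAU (OmegaStar.mem_of_finite_exits hfin hA q)

theorem topologicalWeight_le_continuum [T2Space X] (h : IsContinuousImageOfOmegaStar X) :
    topologicalWeight X ≤ Cardinal.continuum := by
  obtain ⟨Q, hQ, hsurj⟩ := h
  let B : Set ℕ → Set X := fun A => (Q '' {p | A ∈ p.1}ᶜ)ᶜ
  have hB : TopologicalSpace.IsTopologicalBasis (range B) := by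
    refine TopologicalSpace.isTopologicalBasis_of_isOpen_of_nhds ?_ ?_
    · rintro _ ⟨A, rfl⟩
      exact ((OmegaStar.isOpen_setOf_mem A).isClosed_compl.isCompact.image hQ).isClosed.isOpen_compl
    · intro x V hx hV
      obtain ⟨A, h1, h2⟩ := OmegaStar.exists_clopen_between
        ((isClosed_singleton (x := x)).preimage hQ).isCompact (hV.preimage hQ)
        (preimage_mono (singleton_subset_iff.2 hx))
      refine ⟨B A, mem_range_self A, ?_, ?_⟩
      · rintro ⟨p, hp, hpx⟩
        exact hp (h1 hpx)
      · intro y hy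
        obtain ⟨q, rfl⟩ := hsurj y
        by_contra hyV
        exact hy ⟨q, fun hq => hyV (h2 hq), rfl⟩
  refine (ciInf_le' _ (⟨range B, hB⟩ : {B : Set (Set X) //
    TopologicalSpace.IsTopologicalBasis B})).trans ?_
  have := Cardinal.mk_range_le_lift (f := B)
  simpa using this

end Images

/-! ### Finite partitions and the adjacency graph of their cells. -/

section Cells

variable {X ι : Type*}

/-- The cell of `x` in the finite partition generated by the sets `b i`, `i ∈ G`. -/
def cell (b : ι → Set X) (G : Finset ι) (x : X) : Set X := {z | ∀ i ∈ G, z ∈ b i ↔ x ∈ b i}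

variable {b : ι → Set X} {G G' : Finset ι} {x y z : X}

theorem mem_cell_self : x ∈ cell b G x := fun _ _ => Iff.rfl

theorem cell_eq_of_mem (h : y ∈ cell b G x) : cell b G y = cell b G x := by
  ext z
  exact forall₂_congr fun i hi => by rw [h i hi]

theorem cell_anti (h : G ⊆ G') : cell b G' x ⊆ cell b G x := fun _ hz i hi => hz i (h hi)

theorem finite_range_cell (b : ι → Set X) (G : Finset ι) : (range (cell b G)).Finite := by
  classical
  refine (G.powerset.finite_toSet.image fun H => {z | ∀ i ∈ G, z ∈ b i ↔ i ∈ H}).subset ?_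
  rintro _ ⟨x, rfl⟩
  refine ⟨G.filter (x ∈ b ·), Finset.mem_coe.2 (Finset.mem_powerset.2 (Finset.filter_subset _ _)), ?_⟩
  ext z
  refine forall₂_congr fun i hi => ?_
  simp [hi]

variable [TopologicalSpace X]

theorem exists_mem_closure_cell (G : Finset ι) {T : Set X} (hz : z ∈ closure T) :
    ∃ y ∈ T, z ∈ closure (cell b G y) := by
  have hT : T ⊆ ⋃₀ (cell b G '' T) := fun y hy => ⟨_, mem_image_of_mem _ hy, mem_cell_self⟩
  have hfin : (cell b G '' T).Finite := (finite_range_cell b G).subset (image_subset_range _ _)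
  have := closure_mono hT hz
  rw [sUnion_eq_biUnion, hfin.closure_biUnion] at this
  simpa using this

/-- Two cells are adjacent if the image of the closure of the first meets the closure of the
second. -/
def CellAdj (f : X → X) (b : ι → Set X) (G : Finset ι) (x y : X) : Prop :=
  (f '' closure (cell b G x) ∩ closure (cell b G y)).Nonempty

variable {f : X → X}

theorem CellAdj.anti (h : G ⊆ G') (hxy : CellAdj f b G' x y) : CellAdj f b G x y :=
  hxy.mono (inter_subset_inter (image_mono (closure_mono (cell_anti h)))
    (closure_mono (cell_anti h)))

theorem CellAdj.congr {x' y' : X} (hx : x' ∈ cell b G x) (hy : y' ∈ cell b G y) :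
    CellAdj f b G x' y' ↔ CellAdj f b G x y := by
  unfold CellAdj
  rw [cell_eq_of_mem hx, cell_eq_of_mem hy]

theorem cellAdj_apply (x : X) : CellAdj f b G x (f x) :=
  ⟨f x, mem_image_of_mem f (subset_closure mem_cell_self), subset_closure mem_cell_self⟩

/-- For a weakly incompressible map the graph of cells is strongly connected. -/
theorem WeaklyIncompressible.transGen_cellAdj (hf : WeaklyIncompressible f) (b : ι → Set X)
    (G : Finset ι) (x y : X) : Relation.TransGen (CellAdj f b G) x y := by
  let S : Set X := {y | Relation.TransGen (CellAdj f b G) x y}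
  have hxS : f x ∈ S := .single (cellAdj_apply x)
  -- Otherwise `f z` is in the closure of an unreachable cell while `z` is in the closure of a
  -- reachable one, and these two are adjacent.
  have hS : ∀ z ∈ closure S, f z ∈ interior S := by
    intro z hz
    by_contra hfz
    obtain ⟨u, hu, hzu⟩ := exists_mem_closure_cell (b := b) G hz
    have hfz' : f z ∈ closure Sᶜ := by rwa [closure_compl]
    obtain ⟨v, hv, hzv⟩ := exists_mem_closure_cell (b := b) G hfz'
    exact hv (Relation.TransGen.tail hu ⟨f z, mem_image_of_mem f hzu, hzv⟩)
  by_contra hy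
  refine hf (interior S) isOpen_interior ?_ ?_ ?_
  · exact nonempty_iff_ne_empty.1 ⟨_, hS _ (subset_closure hxS)⟩
  · intro h
    exact hy (interior_subset (h ▸ mem_univ y : y ∈ interior S))
  · rintro _ ⟨z, hz, rfl⟩
    exact hS z (closure_mono interior_subset hz)

end Cells

/-! ### Closed walks in strongly connected relations. -/

section Walks

variable {X : Type*} {r : X → X → Prop}

/-- `w` is a walk of length `l` from `x` to `y` along the relation `r`. -/
structure IsWalk (r : X → X → Prop) (x y : X) (l : ℕ) (w : ℕ → X) : Prop where
  start : w 0 = x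
  finish : w l = y
  step : ∀ n < l, r (w n) (w (n + 1))

theorem IsWalk.append {x y z : X} {l m : ℕ} {v w : ℕ → X} (hv : IsWalk r x y l v)
    (hw : IsWalk r y z m w) : IsWalk r x z (l + m) fun n => if n < l then v n else w (n - l) where
  start := by
    rcases Nat.eq_zero_or_pos l with rfl | hl
    · simp [hw.start, ← hv.start, ← hv.finish]
    · simp [hl, hv.start]
  finish := by simp [hw.finish]
  step n hn := by
    rcases lt_trichotomy (n + 1) l with h | h | h
    · simpa [h, (Nat.lt_succ_self n).trans h] using hv.step n (by omega)
    · have := hv.step n (by omega)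
      rw [h, hv.finish, ← hw.start] at this
      simpa [h, show n < l by omega] using this
    · have := hw.step (n - l) (by omega)
      rw [show n - l + 1 = n + 1 - l by omega] at this
      simpa [show ¬ n < l by omega, show ¬ n + 1 < l by omega] using this

theorem Relation.TransGen.exists_isWalk {x y : X} (h : Relation.TransGen r x y) :
    ∃ l w, 0 < l ∧ IsWalk r x y l w := by
  have single : ∀ {x y : X}, r x y → IsWalk r x y 1 fun n => if n = 0 then x else y :=
    fun hxy => ⟨by simp, by simp, fun n hn => by simpa [Nat.lt_one_iff.1 hn] using hxy⟩
  induction h with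
  | single h => exact ⟨1, _, one_pos, single h⟩
  | tail _ h ih =>
    obtain ⟨l, w, hl, hw⟩ := ih
    exact ⟨l + 1, _, by omega, hw.append (single h)⟩

/-- In a strongly connected relation every finite set lies on a closed walk through a given
point. -/
theorem exists_isWalk_visiting (h : ∀ x y, Relation.TransGen r x y) (x₀ : X) {Y : Set X}
    (hY : Y.Finite) : ∃ l w, 0 < l ∧ IsWalk r x₀ x₀ l w ∧ ∀ y ∈ Y, ∃ n < l, w n = y := by
  induction Y, hY using Set.Finite.induction_on with
  | empty =>
    obtain ⟨l, w, hl, hw⟩ := (h x₀ x₀).exists_isWalk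
    exact ⟨l, w, hl, hw, by simp⟩
  | @insert a Y _ _ ih =>
    obtain ⟨l, w, hl, hw, hv⟩ := ih
    obtain ⟨l₁, w₁, h₁, hw₁⟩ := (h x₀ a).exists_isWalk
    obtain ⟨l₂, w₂, h₂, hw₂⟩ := (h a x₀).exists_isWalk
    refine ⟨_, _, ?_, (hw.append hw₁).append hw₂, ?_⟩
    · omega
    rintro y (rfl | hy)
    · exact ⟨l + l₁, by omega, by simp [hw₂.start]⟩
    · obtain ⟨n, hn, rfl⟩ := hv y hy
      exact ⟨n, by omega, by simp [hn, show n < l + l₁ by omega]⟩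

/-- A closed walk can be repeated periodically. -/
theorem IsWalk.periodic {x : X} {l : ℕ} {w : ℕ → X} (hl : 0 < l) (hw : IsWalk r x x l w) (n : ℕ) :
    r (w (n % l)) (w ((n + 1) % l)) := by
  have hn := Nat.mod_lt n hl
  have := hw.step (n % l) hn
  rw [← Nat.mod_add_mod]
  rcases (Nat.succ_le_of_lt hn).lt_or_eq with h | h
  · rwa [Nat.mod_eq_of_lt h]
  · replace h : n % l + 1 = l := h
    rw [h, hw.finish, ← hw.start] at this
    rwa [h, Nat.mod_self]

end Walks

/-! ### Transfinite construction of the sets `e i`. -/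

section Tracking

open scoped Nat

variable {X ι : Type*} [TopologicalSpace X]

/-- On the block `[k!, (k+1)!)` the closed walk `w` along adjacent `G`-cells visits every `G`-cell,
and the sets `e i`, `i ∈ F`, record when it is in `b i`. -/
structure Tracks (f : X → X) (b : ι → Set X) (x₀ : X) (F G : Finset ι) (e : ι → Set ℕ) (k : ℕ)
    (w : ℕ → X) : Prop where
  start : w k ! = x₀
  finish : w (k + 1)! = x₀
  step : ∀ n, k ! ≤ n → n < (k + 1)! → CellAdj f b G (w n) (w (n + 1))
  visit : ∀ y, ∃ n, k ! ≤ n ∧ n < (k + 1)! ∧ w n ∈ cell b G y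
  mem_iff : ∀ n, k ! ≤ n → n < (k + 1)! → ∀ i ∈ F, n ∈ e i ↔ w n ∈ b i

variable {f : X → X} {b : ι → Set X} {x₀ : X} {F F' G G' : Finset ι} {e e' : ι → Set ℕ} {k : ℕ}
  {w : ℕ → X}

theorem Tracks.mono (h : Tracks f b x₀ F' G' e k w) (hF : F ⊆ F') (hG : G ⊆ G') :
    Tracks f b x₀ F G e k w where
  start := h.start
  finish := h.finish
  step n h1 h2 := (h.step n h1 h2).anti hG
  visit y := by
    obtain ⟨n, h1, h2, h3⟩ := h.visit y
    exact ⟨n, h1, h2, cell_anti hG h3⟩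
  mem_iff n h1 h2 i hi := h.mem_iff n h1 h2 i (hF hi)

/-- Every finite subfamily indexed by `S` can be tracked on all but finitely many blocks, with
respect to all finite partitions. -/
def Trackable (f : X → X) (b : ι → Set X) (x₀ : X) (S : Set ι) (e : ι → Set ℕ) : Prop :=
  ∀ F : Finset ι, ↑F ⊆ S → ∀ G : Finset ι, ∀ᶠ k in atTop, ∃ w, Tracks f b x₀ F G e k w

theorem Trackable.congr {S : Set ι} (h : Trackable f b x₀ S e) (he : ∀ i ∈ S, e i = e' i) :
    Trackable f b x₀ S e' := by
  intro F hF G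
  filter_upwards [h F hF G] with k ⟨w, hw⟩
  exact ⟨w, hw.start, hw.finish, hw.step, hw.visit, fun n h1 h2 i hi =>
    he i (hF hi) ▸ hw.mem_iff n h1 h2 i hi⟩

/-- A closed walk of length `l` through all cells is repeated periodically. Factorials serve as
block ends because `l` divides `k!` once `k ≥ l`, so every late block starts and ends at `x₀`. -/
theorem WeaklyIncompressible.trackable_empty (hf : WeaklyIncompressible f) (b : ι → Set X)
    (x₀ : X) (e : ι → Set ℕ) : Trackable f b x₀ ∅ e := by
  intro F hF G
  have : Finite (range (cell b G)) := finite_range_cell b G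
  have hY : (range (rangeSplitting (cell b G))).Finite := finite_range _
  obtain ⟨l, w, hl, hw, hv⟩ := exists_isWalk_visiting (hf.transGen_cellAdj b G) x₀ hY
  filter_upwards [eventually_ge_atTop l] with k hk
  have hdvd : l ∣ k ! := Nat.dvd_factorial hl hk
  have hdvd' : l ∣ (k + 1)! := Nat.dvd_factorial hl (by omega)
  refine ⟨fun n => w (n % l), ?_, ?_, fun n _ _ => hw.periodic hl n, fun y => ?_, ?_⟩
  · simp only [Nat.mod_eq_zero_of_dvd hdvd, hw.start]
  · simp only [Nat.mod_eq_zero_of_dvd hdvd', hw.start]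
  · obtain ⟨n, hn, hny⟩ := hv _ (mem_range_self ⟨cell b G y, mem_range_self y⟩)
    have hzy : cell b G (w n) = cell b G y := by
      rw [hny]
      exact apply_rangeSplitting (cell b G) _
    refine ⟨k ! + n, by omega, ?_, ?_⟩
    · have : 1 * k ! ≤ k * k ! := Nat.mul_le_mul_right _ (by omega)
      have := Nat.self_le_factorial k
      rw [Nat.factorial_succ, add_mul]
      nlinarith
    · simp only [Nat.add_mod, Nat.mod_eq_zero_of_dvd hdvd, zero_add,
        Nat.mod_eq_of_lt hn]
      exact hzy ▸ mem_cell_self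
  · intro n _ _ i hi
    exact absurd (hF hi) (notMem_empty i)

/-- The finite graph underlying `Tracks`. -/
structure CellGraph (ι : Type*) (F : Finset ι) where
  size : ℕ
  adj : Set (Fin size × Fin size)
  base : Fin size
  label : Fin size → Set F

instance CellGraph.countable (F : Finset ι) : Countable (CellGraph ι F) := by
  let enc : CellGraph ι F → Σ n, Set (Fin n × Fin n) × Fin n × (Fin n → Set F) :=
    fun D => ⟨D.size, D.adj, D.base, D.label⟩
  refine Function.Injective.countable (f := enc) ?_
  rintro ⟨n, a, c, l⟩ ⟨n', a', c', l'⟩ h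
  simp only [enc, Sigma.mk.injEq] at h
  obtain ⟨rfl, h⟩ := h
  simpa using h

/-- The walks of `Tracks` in terms of the finite graph only. -/
def CellGraph.Trackable (D : CellGraph ι F) (e : ι → Set ℕ) (k : ℕ) : Prop :=
  ∃ v : ℕ → Fin D.size, v k ! = D.base ∧ v (k + 1)! = D.base ∧
    (∀ n, k ! ≤ n → n < (k + 1)! → (v n, v (n + 1)) ∈ D.adj) ∧
    (∀ a, ∃ n, k ! ≤ n ∧ n < (k + 1)! ∧ v n = a) ∧
    ∀ n, k ! ≤ n → n < (k + 1)! → ∀ i : F, n ∈ e i ↔ i ∈ D.label (v n)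

/-- As `F ⊆ G`, membership in `b i` for `i ∈ F` is constant on `G`-cells, so walks of points and
walks of cells are interchangeable. The point `x₀` must represent its own cell, since walks end at
`x₀` exactly. -/
theorem exists_cellGraph (f : X → X) (b : ι → Set X) (x₀ : X) (h : F ⊆ G) :
    ∃ D : CellGraph ι F, ∀ e k, (∃ w, Tracks f b x₀ F G e k w) ↔ D.Trackable e k := by
  have : Finite (range (cell b G)) := finite_range_cell b G
  let ψ := Finite.equivFin (range (cell b G))
  let c : X → Fin (Nat.card (range (cell b G))) := fun x => ψ ⟨_, mem_range_self x⟩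
  have hc : ∀ x y, c x = c y ↔ x ∈ cell b G y := by
    intro x y
    simp only [c, EmbeddingLike.apply_eq_iff_eq, Subtype.mk.injEq]
    exact ⟨fun h => h ▸ mem_cell_self, cell_eq_of_mem⟩
  obtain ⟨g, hg, hg₀⟩ : ∃ g : _ → X, (∀ a, c (g a) = a) ∧ g (c x₀) = x₀ := by
    have hsurj : ∀ a, ∃ x, c x = a := by
      intro a
      obtain ⟨⟨_, x, rfl⟩, rfl⟩ := ψ.surjective a
      exact ⟨x, rfl⟩
    choose g hg using hsurj
    classical
    refine ⟨fun a => if a = c x₀ then x₀ else g a, fun a => ?_, if_pos rfl⟩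
    by_cases ha : a = c x₀
    · simp only [ha, if_true]
    · simp only [if_neg ha, hg]
  have hadj : ∀ x y, CellAdj f b G (g (c x)) (g (c y)) ↔ CellAdj f b G x y := fun x y =>
    CellAdj.congr ((hc _ _).1 (hg _)) ((hc _ _).1 (hg _))
  refine ⟨⟨_, {p | CellAdj f b G (g p.1) (g p.2)}, c x₀, fun a => {i | g a ∈ b i}⟩,
    fun e k => ⟨?_, ?_⟩⟩
  · rintro ⟨w, hw⟩
    refine ⟨fun n => c (w n), congrArg c hw.start, congrArg c hw.finish,
      fun n h1 h2 => (hadj _ _).2 (hw.step n h1 h2), fun a => ?_, fun n h1 h2 i => ?_⟩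
    · obtain ⟨n, h1, h2, h3⟩ := hw.visit (g a)
      exact ⟨n, h1, h2, ((hc _ _).2 h3).trans (hg a)⟩
    · rw [hw.mem_iff n h1 h2 i i.2]
      exact (((hc _ _).1 (hg (c (w n)))) i (h i.2)).symm
  · rintro ⟨v, h1, h2, h3, h4, h5⟩
    refine ⟨fun n => g (v n), ?_, ?_, h3, fun y => ?_, fun n hn hn' i hi => h5 n hn hn' ⟨i, hi⟩⟩
    · exact (congrArg g h1).trans hg₀
    · exact (congrArg g h2).trans hg₀
    · obtain ⟨n, hn, hn', hy⟩ := h4 (c y)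
      exact ⟨n, hn, hn', (hc _ _).1 (by rw [hg, hy])⟩

/-- For fixed `F` countably many partitions suffice to test trackability. -/
theorem exists_countable_partitions (f : X → X) (b : ι → Set X) (x₀ : X) (F : Finset ι) :
    ∃ 𝒢 : Set (Finset ι), 𝒢.Countable ∧ (∀ G ∈ 𝒢, F ⊆ G) ∧ ∀ G, F ⊆ G → ∃ G' ∈ 𝒢, ∀ e k,
      (∃ w, Tracks f b x₀ F G' e k w) → ∃ w, Tracks f b x₀ F G e k w := by
  choose D hD using fun G : {G // F ⊆ G} => exists_cellGraph f b x₀ G.2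
  refine ⟨Subtype.val '' range (rangeSplitting D), (countable_range _).image _, ?_, fun G hG => ?_⟩
  · rintro _ ⟨G, -, rfl⟩
    exact G.2
  · refine ⟨_, mem_image_of_mem _ (mem_range_self ⟨D ⟨G, hG⟩, mem_range_self _⟩), fun e k hw => ?_⟩
    rw [hD] at hw
    rw [hD ⟨G, hG⟩]
    simpa only [apply_rangeSplitting] using hw

/-- Take `N k` to be the largest `n ≤ k` with `P n k`; one exists as soon as `P 0 k` holds. -/
theorem exists_diagonal {P : ℕ → ℕ → Prop} (h : ∀ n, ∀ᶠ k in atTop, P n k) :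
    ∃ N : ℕ → ℕ, (∀ n, ∀ᶠ k in atTop, n ≤ N k) ∧ ∀ᶠ k in atTop, P (N k) k := by
  classical
  refine ⟨fun k => Nat.findGreatest (P · k) k, fun n => ?_, ?_⟩
  · filter_upwards [h n, eventually_ge_atTop n] with k hk hn
    exact Nat.le_findGreatest hn hk
  · filter_upwards [h 0] with k hk
    exact Nat.findGreatest_spec (P := (P · k)) (Nat.zero_le k) hk

theorem factorial_block_unique {k l n : ℕ} (hk : k ! ≤ n) (hk' : n < (k + 1)!) (hl : l ! ≤ n)
    (hl' : n < (l + 1)!) : k = l := by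
  rcases lt_trichotomy k l with h | h | h
  · exact absurd (Nat.factorial_le (show k + 1 ≤ l from h)) (by omega)
  · exact h
  · exact absurd (Nat.factorial_le (show l + 1 ≤ k from h)) (by omega)

/-- A trackable countable family can be extended by one more index. -/
theorem Trackable.exists_update [DecidableEq ι] {S : Set ι} (hS : S.Countable)
    (h : Trackable f b x₀ S e) {a : ι} (ha : a ∉ S) :
    ∃ A : Set ℕ, Trackable f b x₀ (insert a S) (Function.update e a A) := by
  choose 𝒢 h𝒢 hsub hrep using fun F => exists_countable_partitions f b x₀ (insert a F)
  let R : Set (Finset ι × Finset ι) := {p | ↑p.1 ⊆ S ∧ p.2 ∈ 𝒢 p.1}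
  have hR : R.Countable := by
    have h1 : {F : Finset ι | ↑F ⊆ S}.Countable := by
      refine ((Set.countable_ofPred_finite_subset hS).preimage_of_injOn
        (f := fun F : Finset ι => (F : Set ι)) Finset.coe_injective.injOn).mono fun F hF => ?_
      exact ⟨F.finite_toSet, hF⟩
    refine (h1.biUnion fun F _ => ((h𝒢 F).image (Prod.mk F))).mono ?_
    rintro ⟨F, G⟩ ⟨h2, h3⟩
    exact mem_biUnion h2 (mem_image_of_mem _ h3)
  have hRne : R.Nonempty := by
    obtain ⟨G, hG, -⟩ := hrep ∅ (insert a ∅) subset_rfl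
    exact ⟨(∅, G), by simp, hG⟩
  obtain ⟨s, hs⟩ := hR.exists_eq_range hRne
  -- Cumulative unions: tracking stage `N k` meets every requirement `s m` with `m ≤ N k`.
  let Fs : ℕ → Finset ι := fun n => (Finset.range (n + 1)).biUnion fun i => (s i).1
  let Gs : ℕ → Finset ι := fun n => (Finset.range (n + 1)).biUnion fun i => (s i).2
  have hFs : ∀ n, ↑(Fs n) ⊆ S := by
    intro n i hi
    obtain ⟨m, -, hm⟩ := Finset.mem_biUnion.1 (Finset.mem_coe.1 hi)
    exact (hs ▸ mem_range_self m : s m ∈ R).1 hm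
  obtain ⟨N, hN, hNw⟩ := exists_diagonal fun n => h (Fs n) (hFs n) (Gs n)
  obtain ⟨w, hw⟩ : ∃ w : ℕ → ℕ → X, ∀ᶠ k in atTop, Tracks f b x₀ (Fs (N k)) (Gs (N k)) e k (w k) := by
    classical
    refine ⟨fun k => if hk : ∃ w, Tracks f b x₀ (Fs (N k)) (Gs (N k)) e k w then hk.choose
      else fun _ => x₀, ?_⟩
    filter_upwards [hNw] with k hk
    simpa only [dif_pos hk] using hk.choose_spec
  let A : Set ℕ := {n | ∃ k, k ! ≤ n ∧ n < (k + 1)! ∧ w k n ∈ b a}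
  refine ⟨A, ?_⟩
  have key : ∀ F : Finset ι, ↑F ⊆ S → ∀ G, insert a F ⊆ G → ∀ᶠ k in atTop,
      ∃ w, Tracks f b x₀ (insert a F) G (Function.update e a A) k w := by
    intro F hF G hG
    obtain ⟨G', hG', himp⟩ := hrep F G hG
    obtain ⟨m, hm⟩ : (F, G') ∈ range s := hs ▸ ⟨hF, hG'⟩
    filter_upwards [hw, hN m] with k hk hmk
    refine himp _ _ ⟨w k, ?_⟩
    have hmem : m ∈ Finset.range (N k + 1) := by simpa using Nat.lt_succ_of_le hmk
    have hk' := hk.mono (F := F) (G := G')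
      (fun i hi => Finset.mem_biUnion.2 ⟨m, hmem, by rwa [hm]⟩)
      (fun i hi => Finset.mem_biUnion.2 ⟨m, hmem, by rwa [hm]⟩)
    refine ⟨hk'.start, hk'.finish, hk'.step, hk'.visit, fun n h1 h2 i hi => ?_⟩
    rcases Finset.mem_insert.1 hi with hia | hi
    · subst hia
      rw [Function.update_self]
      refine ⟨?_, fun hn => ⟨k, h1, h2, hn⟩⟩
      rintro ⟨l, h3, h4, h5⟩
      rwa [factorial_block_unique h1 h2 h3 h4]
    · rw [Function.update_of_ne (fun hia : i = a => ha (hia ▸ hF hi))]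
      exact hk'.mem_iff n h1 h2 i hi
  intro F hF G
  have hF' : ↑(F.erase a) ⊆ S := by
    intro i hi
    rw [Finset.coe_erase] at hi
    exact (hF hi.1).resolve_left hi.2
  filter_upwards [key (F.erase a) hF' (insert a (F.erase a) ∪ G) Finset.subset_union_left]
    with k ⟨w, hw⟩
  refine ⟨w, hw.mono (fun i hi => ?_) Finset.subset_union_right⟩
  by_cases hia : i = a <;> simp [hia, hi]

/-- If all initial segments of the index set are countable, the whole family can be tracked. -/
theorem WeaklyIncompressible.exists_trackable (hf : WeaklyIncompressible f) (b : ι → Set X)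
    (x₀ : X) (r : ι → ι → Prop) [IsWellOrder ι r] (hr : ∀ a, {i | r i a}.Countable) :
    ∃ e : ι → Set ℕ, Trackable f b x₀ univ e := by
  classical
  let ext (a : ι) (e : ι → Set ℕ) : Set ℕ :=
    if h : ∃ A, Trackable f b x₀ (insert a {i | r i a}) (Function.update e a A) then h.choose else ∅
  have wf : WellFounded r := IsWellFounded.wf
  let e : ι → Set ℕ := wf.fix fun a ih => ext a fun i => if h : r i a then ih i h else ∅
  have he : ∀ a, e a = ext a fun i => if r i a then e i else ∅ := by
    intro a
    rw [show e a = _ from wf.fix_eq _ a]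
    congr 1
  -- Trackability has finite character, and a nonempty finite `F` lies in the closed initial segment
  -- of its largest element.
  have union : ∀ T : Set ι, (∀ a ∈ T, Trackable f b x₀ {i | r i a ∨ i = a} e) →
      Trackable f b x₀ T e := by
    intro T hT F hF G
    rcases F.eq_empty_or_nonempty with rfl | hne
    · exact hf.trackable_empty b x₀ e ∅ (by simp) G
    · let _ := linearOrderOfSTO r
      obtain ⟨m, hm, hmax⟩ := F.exists_max_image id hne
      exact hT m (hF hm) F (fun i hi => (hmax i hi).symm) G
  refine ⟨e, union univ fun a _ => ?_⟩
  induction a using wf.induction with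
  | _ a ih =>
    replace ih := fun i hi => ih i hi (mem_univ i)
    have h1 := (union {i | r i a} ih).congr (e' := fun i => if r i a then e i else ∅)
      (fun i hi => (if_pos hi).symm)
    have h2 := h1.exists_update (hr a) (a := a) (irrefl_of r a)
    have h3 : Trackable f b x₀ (insert a {i | r i a})
        (Function.update (fun i => if r i a then e i else ∅) a (e a)) := by
      rw [he a]
      simp only [ext]
      rw [dif_pos h2]
      exact h2.choose_spec
    have h4 : insert a {i | r i a} = {i | r i a ∨ i = a} := by
      ext i
      simp [or_comm]
    rw [h4] at h3
    refine h3.congr fun i hi => ?_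
    by_cases hia : i = a
    · subst hia
      simp
    · simp [hia, hi.resolve_right hia]

end Tracking

/-! ### The quotient map coded by a trackable family. -/

section Quotient

open scoped Nat

variable {X ι : Type*} [TopologicalSpace X] {f : X → X} {b : ι → Set X} {x₀ : X} {e : ι → Set ℕ}

theorem exists_factorial_block (K : ℕ) {n : ℕ} (hn : K ! ≤ n) :
    ∃ k, K ≤ k ∧ k ! ≤ n ∧ n < (k + 1)! := by
  classical
  have hK : K ≤ n := (Nat.self_le_factorial K).trans hn
  have h1 := Nat.findGreatest_spec (P := fun k => k ! ≤ n) hK hn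
  have h2 := Nat.le_findGreatest (P := fun k => k ! ≤ n) hK hn
  refine ⟨_, h2, h1, ?_⟩
  by_contra! h
  have := Nat.le_findGreatest (P := fun k => k ! ≤ n) ((Nat.self_le_factorial _).trans h) h
  omega

/-- The side of `b i` that the ultrafilter `p` chooses. -/
def side (b : ι → Set X) (e : ι → Set ℕ) (p : OmegaStar) (i : ι) : Set X :=
  {x | x ∈ b i ↔ e i ∈ p.1}

theorem eventually_mem_iff (p : OmegaStar) (A : Set ℕ) : ∀ᶠ n in p.1, n ∈ A ↔ A ∈ p.1 := by
  by_cases hA : A ∈ p.1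
  · filter_upwards [hA] with n hn using iff_of_true hn hA
  · filter_upwards [Ultrafilter.compl_mem_iff_notMem.2 hA] with n hn using iff_of_false hn hA

theorem Trackable.eventually_cofinite (h : Trackable f b x₀ univ e) (F : Finset ι) :
    ∀ᶠ n in cofinite, ∃ x y, (∀ i ∈ F, n ∈ e i ↔ x ∈ b i) ∧ (∀ i ∈ F, n + 1 ∈ e i ↔ y ∈ b i) ∧
      CellAdj f b F x y := by
  obtain ⟨K, hK⟩ := eventually_atTop.1 (h F (subset_univ _) F)
  rw [Nat.cofinite_eq_atTop]
  filter_upwards [eventually_ge_atTop K !] with n hn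
  obtain ⟨k, hKk, hk, hk'⟩ := exists_factorial_block K hn
  obtain ⟨w, hw⟩ := hK k hKk
  refine ⟨w n, w (n + 1), hw.mem_iff n hk hk', ?_, hw.step n hk hk'⟩
  rcases (Nat.succ_le_of_lt hk').lt_or_eq with hlt | heq
  · exact hw.mem_iff (n + 1) (by omega) hlt
  · replace heq : n + 1 = (k + 1)! := heq
    -- At a block boundary `n + 1` is recorded by the next walk, which starts at `x₀`, where this
    -- one ends.
    obtain ⟨v, hv⟩ := hK (k + 1) (by omega)
    rw [heq, hw.finish, ← hv.start]
    refine hv.mem_iff _ le_rfl ?_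
    exact Nat.factorial_lt_of_lt (by omega) (by omega)

theorem Trackable.nonempty_iInter_side (h : Trackable f b x₀ univ e) (p : OmegaStar)
    (F : Finset ι) : (⋂ i ∈ F, side b e p i).Nonempty := by
  have h1 := OmegaStar.cofinite_le p (h.eventually_cofinite F)
  have h2 : ∀ᶠ n in p.1, ∀ i ∈ F, n ∈ e i ↔ e i ∈ p.1 :=
    (Filter.eventually_all_finset F).2 fun i _ => eventually_mem_iff p (e i)
  obtain ⟨n, ⟨x, -, hx, -⟩, hn⟩ := (Filter.Eventually.and h1 h2).exists
  exact ⟨x, mem_iInter₂.2 fun i hi => (hx i hi).symm.trans (hn i hi)⟩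

theorem Trackable.exists_mem_closure_side [CompactSpace X] (h : Trackable f b x₀ univ e)
    (p : OmegaStar) : ∃ x, ∀ i, x ∈ closure (side b e p i) := by
  have := CompactSpace.iInter_nonempty (t := fun i => closure (side b e p i))
    (fun i => isClosed_closure) fun F => (h.nonempty_iInter_side p F).mono
      (iInter₂_mono fun i _ => subset_closure)
  simpa [Set.Nonempty] using this

section Base

variable (hb : TopologicalSpace.IsTopologicalBasis (range b))

include hb

theorem mem_of_mem_closure_side {p : OmegaStar} {i : ι} {x : X} (hx : x ∈ closure (side b e p i))
    (hi : x ∈ b i) : e i ∈ p.1 := by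
  obtain ⟨y, hy, hys⟩ := mem_closure_iff.1 hx _ (hb.isOpen (mem_range_self i)) hi
  exact hys.1 hy

theorem exists_closure_subset [CompactSpace X] [T2Space X] {V : Set X} (hV : IsOpen V) {x : X} (hx : x ∈ V) :
    ∃ i, x ∈ b i ∧ closure (b i) ⊆ V := by
  obtain ⟨_, ⟨i, rfl⟩, hi, hiV⟩ := hb.exists_closure_subset (hV.mem_nhds hx)
  exact ⟨i, hi, hiV⟩

theorem closure_side_unique [CompactSpace X] [T2Space X] {p : OmegaStar} {x y : X}
    (hx : ∀ i, x ∈ closure (side b e p i)) (hy : ∀ i, y ∈ closure (side b e p i)) : x = y := by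
  by_contra hne
  obtain ⟨i, hi, hiV⟩ := exists_closure_subset hb (isOpen_compl_singleton (x := y)) hne
  have hip := mem_of_mem_closure_side hb (hx i) hi
  exact hiV (closure_mono (fun z hz => hz.2 hip) (hy i)) rfl

/-- If it failed, some basic `b j` around `x` would have `f '' closure (b j)` disjoint from the
closed side. But for some `n ∈ e j` adjacency gives a point of `closure (b j)` mapped into that
side. -/
theorem Trackable.apply_mem_closure_side [CompactSpace X] [T2Space X] (hf : Continuous f)
    (h : Trackable f b x₀ univ e) {p : OmegaStar} {x : X} (hx : ∀ i, x ∈ closure (side b e p i))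
    (i : ι) : f x ∈ closure (side b e (OmegaStar.shift p) i) := by
  classical
  by_contra hfx
  obtain ⟨j, hj, hjV⟩ := exists_closure_subset hb (isClosed_closure.isOpen_compl.preimage hf) hfx
  have hjp := mem_of_mem_closure_side hb (hx j) hj
  have h1 := OmegaStar.cofinite_le p (h.eventually_cofinite {i, j})
  have h2 : ∀ᶠ n in p.1, n + 1 ∈ e i ↔ e i ∈ (OmegaStar.shift p).1 :=
    eventually_mem_iff (OmegaStar.shift p) (e i)
  obtain ⟨n, ⟨⟨y, z, hy, hz, u, ⟨v, hv, rfl⟩, hu⟩, hn⟩, hnj⟩ :=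
    ((Filter.Eventually.and h1 h2).and hjp).exists
  have hyj : y ∈ b j := (hy j (by simp)).1 hnj
  have hzi : z ∈ side b e (OmegaStar.shift p) i := (hz i (by simp)).symm.trans hn
  refine hjV (closure_mono (fun t ht => (ht j (by simp)).2 hyj) hv) ?_
  exact closure_mono (fun t ht => (ht i (by simp)).trans hzi) hu

theorem Trackable.isQuotientOfShift [CompactSpace X] [T2Space X] (hf : Continuous f)
    (h : Trackable f b x₀ univ e) : IsQuotientOfShift f := by
  choose Q hQ using h.exists_mem_closure_side
  have hcont : Continuous Q := by
    refine continuous_iff_continuousAt.2 fun p V hV => ?_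
    obtain ⟨U, hUV, hU, hpU⟩ := mem_nhds_iff.1 hV
    obtain ⟨i, hi, hiU⟩ := exists_closure_subset hb hU hpU
    have hip := mem_of_mem_closure_side hb (hQ p i) hi
    change ∀ᶠ q in 𝓝 p, Q q ∈ V
    filter_upwards [(OmegaStar.isOpen_setOf_mem (e i)).mem_nhds hip] with q hq
    exact hUV (hiU (closure_mono (fun z hz => hz.2 hq) (hQ q i)))
  refine ⟨Q, hcont, ?_, ?_⟩
  · rw [← range_eq_univ, ← (isCompact_range hcont).isClosed.closure_eq]
    refine Dense.closure_eq (dense_iff_inter_open.2 fun U hU ⟨x, hx⟩ => ?_)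
    obtain ⟨i, hi, hiU⟩ := exists_closure_subset hb hU hx
    -- Each late walk visits the cell of `x`, contained in `b i`, so `e i` meets each late block.
    have hinf : (e i).Infinite := by
      refine Set.infinite_of_not_bddAbove fun ⟨m, hm⟩ => ?_
      obtain ⟨k, ⟨w, hw⟩, hk⟩ :=
        ((h {i} (subset_univ _) {i}).and (eventually_gt_atTop m)).exists
      obtain ⟨n, h1, h2, h3⟩ := hw.visit x
      have hn : n ∈ e i := (hw.mem_iff n h1 h2 i (by simp)).2 ((h3 i (by simp)).2 hi)
      have := hm hn
      have := Nat.self_le_factorial k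
      omega
    obtain ⟨p, hp⟩ := OmegaStar.exists_mem_of_infinite hinf
    exact ⟨Q p, hiU (closure_mono (fun z hz => hz.2 hp) (hQ p i)), mem_range_self p⟩
  · funext p
    exact closure_side_unique hb (hQ _) fun i => h.apply_mem_closure_side hb hf (hQ p) i

end Base

theorem exists_basis_mk_eq_topologicalWeight (X : Type*) [TopologicalSpace X] :
    ∃ B : Set (Set X), TopologicalSpace.IsTopologicalBasis B ∧
      Cardinal.mk B = topologicalWeight X := by
  have : Nonempty {B : Set (Set X) // TopologicalSpace.IsTopologicalBasis B} :=
    ⟨⟨_, TopologicalSpace.isTopologicalBasis_opens⟩⟩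
  obtain ⟨B, hB⟩ := ciInf_mem
    fun B : {B : Set (Set X) // TopologicalSpace.IsTopologicalBasis B} => Cardinal.mk B.1
  exact ⟨B.1, B.2, hB⟩

theorem ContinuumHypothesis.exists_wellOrder (hCH : ContinuumHypothesis) {α : Type*}
    (hα : Cardinal.mk α ≤ Cardinal.continuum) :
    ∃ r : α → α → Prop, IsWellOrder α r ∧ ∀ a, {i | r i a}.Countable := by
  obtain ⟨r, hr, hord⟩ := Cardinal.exists_ord_eq α
  refine ⟨r, hr, fun a => ?_⟩
  have h1 : Cardinal.mk {i | r i a} < Cardinal.mk α := by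
    have := Ordinal.typein_lt_type r a
    rw [← hord, Cardinal.lt_ord] at this
    exact this
  -- CH is an equation in universe 0 and is lifted to that of `α`.
  have h2 := congrArg Cardinal.lift hCH
  rw [Cardinal.lift_continuum, Cardinal.lift_aleph, Ordinal.lift_one] at h2
  rw [← Cardinal.le_aleph0_iff_set_countable, ← Cardinal.lt_aleph_one_iff]
  exact h1.trans_le (hα.trans_eq h2)

theorem WeaklyIncompressible.isQuotientOfShift [CompactSpace X] [T2Space X] [Nonempty X]
    (hCH : ContinuumHypothesis) (hX : topologicalWeight X ≤ Cardinal.continuum)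
    (hw : WeaklyIncompressible f) (hf : Continuous f) : IsQuotientOfShift f := by
  obtain ⟨B, hB, hBX⟩ := exists_basis_mk_eq_topologicalWeight X
  obtain ⟨r, hr, hcount⟩ := hCH.exists_wellOrder (hBX.trans_le hX)
  obtain ⟨e, he⟩ := hw.exists_trackable (Subtype.val : B → Set X) (Classical.arbitrary X) r hcount
  exact he.isQuotientOfShift (by rwa [Subtype.range_coe]) hf

end Quotient

theorem mainTheorem5 (hCH : ContinuumHypothesis)
    {X : Type*} [TopologicalSpace X] [CompactSpace X] [T2Space X] [Nonempty X]
    (f : X → X) (hf : Continuous f) :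
    List.TFAE
      [IsQuotientOfShift f,
       topologicalWeight X ≤ Cardinal.continuum ∧ WeaklyIncompressible f,
       IsContinuousImageOfOmegaStar X ∧ WeaklyIncompressible f] := by
  tfae_have 1 → 3 := fun h =>
    ⟨let ⟨Q, hQ, hsurj, _⟩ := h; ⟨Q, hQ, hsurj⟩, .of_isQuotientOfShift h hf⟩
  tfae_have 3 → 2 := fun h => ⟨topologicalWeight_le_continuum h.1, h.2⟩
  tfae_have 2 → 1 := fun h => h.2.isQuotientOfShift hCH h.1 hf
  tfae_finish
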